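/- Let $T$ be (the vertex set of) the rooted infinite dyadic tree with root $o$, let $\partial T$ be its boundary (the infinite paths starting at $o$), and let $\overline T=T\cup\partial T$. For $\alpha,\beta\in\overline T$ write $\alpha\le\beta$ if $\beta=\alpha$ or $\beta$ is a vertex on the path from $o$ to $\alpha$. Let $d_T(\alpha\wedge\beta)\in\mathbb N\cup\{\infty\}$ be the number of common predecessors $\gamma\ge\alpha,\ \gamma\ge\beta$ in $\overline T$, and $d_T(\alpha)=d_T(\alpha\wedge\alpha)$, so that $d_T(\alpha)=\mathrm{dist}(\alpha,o)+1$ for $\alpha\in T$. Equip $\overline T$ with the metric $$2^{-d_T(\alpha\wedge\beta)}-\tfrac12\left(2^{-d_T(\alpha)}+2^{-d_T(\beta)}\right),\qquad 2^{-\infty}=0,$$ and $\overline T^d$ with the coordinatewise order and the sum of the coordinate metrics. Let $0\le s_j<1$ for $j=1,\dots,d$, and let $\pi(\beta)=\prod_{j=1}^d 2^{s_jd_T(\beta_j)}$ for $\beta\in T^d$. For $f:T^d\to[0,\infty)$ and $\alpha\in\overline T^d$ put $(\mathbb If)(\alpha)=\sum_{\gamma\in T^d,\,\gamma\ge\alpha}f(\gamma)\pi(\gamma)$,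 and for $E\subset\overline T^d$ put $$\mathrm{cap}_\pi E=\inf\Big\{\sum_{\gamma\in T^d}f(\gamma)^2\pi(\gamma):\ f\ge0,\ (\mathbb If)(\alpha)\ge1\text{ for all }\alpha\in E\Big\}.$$ For $E\subset\overline T^d$ let $\mathcal S_b(E)=\bigcup_{\beta\in E}\{\omega\in(\partial T)^d:\ \omega\le\beta\}$ be its projection onto the distinguished boundary $(\partial T)^d$. Then there is a constant $C>1$, depending only on $d$ and $\pi$, such that for every compact $E\subset\overline T^d$ $$\mathrm{cap}_\pi\,\mathcal S_b(E)\le\mathrm{cap}_\pi E\le C\,\mathrm{cap}_\pi\,\mathcal S_b(E).$$ -/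

import Mathlib

open scoped NNReal ENNReal

/-- Vertices of the rooted infinite dyadic tree `T`: finite binary words. The root is the empty
word, and the two children of `v` are `v ++ [false]` and `v ++ [true]`. -/
abbrev TreeVertex : Type := List Bool

/-- The closed tree `T ∪ ∂T`: a point is a vertex, or a boundary point, that is an infinite path of
edges starting at the root, encoded by the infinite sequence of left/right choices. -/
inductive ClosedTree : Type
  | vertex (v : TreeVertex) : ClosedTree
  | bdry (ω : ℕ → Bool) : ClosedTree

namespace ClosedTree

/-- `le α β` means that `β` is a predecessor of `α`, i.e. `β` lies on the geodesic from the root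
to `α` (endpoints included). -/
def le : ClosedTree → ClosedTree → Prop
  | vertex a, vertex b => b <+: a
  | bdry ω, vertex b => ∀ (i : ℕ) (h : i < b.length), b[i] = ω i
  | vertex _, bdry _ => False
  | bdry ω, bdry ω' => ω = ω'

theorem le_refl' (α : ClosedTree) : le α α := by
  cases α <;> simp [le]

theorem le_trans' (α β γ : ClosedTree) (h : le α β) (h' : le β γ) : le α γ := by
  rcases α with a | a <;> rcases β with b | b <;> rcases γ with c | c <;> simp only [le] at h h' ⊢
  · exact h'.trans h
  · intro i hi
    have hib : i < b.length := lt_of_lt_of_le hi h'.length_le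
    rw [← h i hib]
    exact h'.getElem hi
  · subst h; exact h'
  · exact h.trans h'

theorem le_antisymm' (α β : ClosedTree) (h : le α β) (h' : le β α) : α = β := by
  rcases α with a | a <;> rcases β with b | b <;> simp only [le] at h h'
  · rw [h.eq_of_length_le h'.length_le]
  · rw [h]

/-- The order of the closed tree. It is reversed with respect to the depth: the root is the largest
element. On `Fin d → ClosedTree` the coordinatewise order is used. -/
instance instPartialOrder : PartialOrder ClosedTree where
  le := le
  le_refl := le_refl'
  le_trans := le_trans'
  le_antisymm := le_antisymm'

/-- The predecessors of a given point form a chain. -/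
theorem chain {γ α β : ClosedTree} (ha : γ ≤ α) (hb : γ ≤ β) : α ≤ β ∨ β ≤ α := by
  change le γ α at ha
  change le γ β at hb
  change le α β ∨ le β α
  rcases γ with c | c <;> rcases α with a | a <;> rcases β with b | b <;> simp only [le] at ha hb ⊢
  · exact (List.prefix_or_prefix_of_prefix ha hb).symm
  · rcases Nat.le_total a.length b.length with h | h
    · right
      rw [List.prefix_iff_getElem]
      exact ⟨h, fun i hi => by rw [ha i hi, hb i (lt_of_lt_of_le hi h)]⟩
    · left
      rw [List.prefix_iff_getElem]
      exact ⟨h, fun i hi => by rw [hb i hi, ha i (lt_of_lt_of_le hi h)]⟩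
  · subst hb; right; exact ha
  · subst ha; left; exact hb
  · left; rw [← ha, ← hb]

/-- The set of common predecessors of `α` and `β`. -/
def commonPred (α β : ClosedTree) : Set ClosedTree := {γ | α ≤ γ ∧ β ≤ γ}

/-- The number `d_T(α ∧ β)` of common predecessors of `α` and `β`, possibly infinite. -/
noncomputable def dT (α β : ClosedTree) : ℕ∞ := (commonPred α β).encard

/-- `d_T(v ∧ v)` of a vertex is its distance to the root plus one. -/
theorem dT_vertex (v : TreeVertex) : dT (vertex v) (vertex v) = ((v.length + 1 : ℕ) : ℕ∞) := by
  have h : commonPred (vertex v) (vertex v)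
      = (fun n : ℕ => vertex (v.take n)) '' (Finset.range (v.length + 1) : Set ℕ) := by
    ext γ
    simp only [commonPred, and_self, Set.mem_ofPred_eq, Set.mem_image, Finset.coe_range, Set.mem_Iio]
    rcases γ with c | c
    · change c <+: v ↔ _
      constructor
      · intro hc
        exact ⟨c.length, Nat.lt_succ_of_le hc.length_le, by rw [← List.prefix_iff_eq_take.mp hc]⟩
      · rintro ⟨n, _, hn⟩
        injection hn with hn
        rw [← hn]
        exact List.take_prefix n v
    · change False ↔ _
      simp
  have hinj : Set.InjOn (fun n : ℕ => vertex (v.take n))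
      (Finset.range (v.length + 1) : Set ℕ) := by
    intro m hm n hn hmn
    simp only [Finset.coe_range, Set.mem_Iio] at hm hn
    injection hmn with hmn
    have := congrArg List.length hmn
    simp only [List.length_take] at this
    omega
  rw [dT, h, hinj.encard_image, Set.encard_coe_eq_coe_finsetCard, Finset.card_range]

theorem dT_comm (α β : ClosedTree) : dT α β = dT β α := by
  simp only [dT, commonPred, and_comm]

theorem dT_le_left (α β : ClosedTree) : dT α β ≤ dT α α :=
  Set.encard_le_encard fun _ h => ⟨h.1, h.1⟩

theorem dT_le_right (α β : ClosedTree) : dT α β ≤ dT β β :=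
  Set.encard_le_encard fun _ h => ⟨h.2, h.2⟩

theorem min_dT_le (α γ β : ClosedTree) : min (dT α γ) (dT γ β) ≤ dT α β := by
  by_cases h : commonPred α γ ⊆ commonPred γ β
  · exact (min_le_left _ _).trans (Set.encard_le_encard fun x hx => ⟨hx.1, (h hx).2⟩)
  · obtain ⟨x, hx, hx'⟩ := Set.not_subset.mp h
    refine (min_le_right _ _).trans (Set.encard_le_encard fun y hy => ⟨?_, hy.2⟩)
    rcases chain hx.2 hy.1 with hxy | hyx
    · exact hx.1.trans hxy
    · exact absurd ⟨hx.2, hy.2.trans hyx⟩ hx'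

theorem dT_ne_top {α β : ClosedTree} (h : α ≠ β) : dT α β ≠ ⊤ := by
  rcases α with a | a
  · refine ne_top_of_le_ne_top ?_ (dT_le_left _ _)
    rw [dT_vertex]; exact ENat.natCast_ne_top _
  · rcases β with b | b
    · refine ne_top_of_le_ne_top ?_ (dT_le_right _ _)
      rw [dT_vertex]; exact ENat.natCast_ne_top _
    · have hab : a ≠ b := fun e => h (by rw [e])
      obtain ⟨i, hi⟩ := Function.ne_iff.mp hab
      rw [dT, Set.encard_ne_top_iff]
      refine Set.Finite.subset (Set.Finite.image vertex (List.finite_length_le Bool i)) ?_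
      rintro (v | c) ⟨h1, h2⟩
      · refine ⟨v, ?_, rfl⟩
        change ∀ (i : ℕ) (h : i < v.length), v[i] = a i at h1
        change ∀ (i : ℕ) (h : i < v.length), v[i] = b i at h2
        change v.length ≤ i
        by_contra hc
        rw [not_le] at hc
        exact hi (by rw [← h1 i hc, ← h2 i hc])
      · change a = c at h1
        change b = c at h2
        exact absurd (h1.trans h2.symm) hab

/-- `2 ^ (-n)`, with the convention `2 ^ (-∞) = 0`. -/
noncomputable def twoPowNeg (n : ℕ∞) : ℝ := if n = ⊤ then 0 else (1 / 2 : ℝ) ^ n.toNat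

theorem twoPowNeg_lt {m n : ℕ∞} (h : m < n) : twoPowNeg n < twoPowNeg m := by
  have hm : m ≠ ⊤ := ne_top_of_lt h
  by_cases hn : n = ⊤
  · simp only [twoPowNeg, hn, hm, if_true, if_false]; positivity
  · simp only [twoPowNeg, hn, hm, if_false]
    lift m to ℕ using hm
    lift n to ℕ using hn
    exact pow_lt_pow_right_of_lt_one₀ (by norm_num) (by norm_num) (by simpa using h)

theorem twoPowNeg_strictAnti : StrictAnti twoPowNeg := fun _ _ h => twoPowNeg_lt h

/-- The metric
`δ(α, β) = 2 ^ (-d_T(α ∧ β)) - (2 ^ (-d_T(α ∧ α)) + 2 ^ (-d_T(β ∧ β))) / 2` of the closed tree.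
On `Fin d → ClosedTree` the topology is the product one, which is the topology of the sum of
the coordinate metrics. -/
noncomputable instance instMetricSpace : MetricSpace ClosedTree where
  dist α β := twoPowNeg (dT α β) - (twoPowNeg (dT α α) + twoPowNeg (dT β β)) / 2
  dist_self α := by ring
  dist_comm α β := by rw [dT_comm α β]; ring
  dist_triangle α γ β := by
    have h1 := twoPowNeg_strictAnti.antitone (min_dT_le α γ β)
    have h2 := twoPowNeg_strictAnti.antitone (dT_le_right α γ)
    have h3 := twoPowNeg_strictAnti.antitone (dT_le_left γ β)
    rcases min_choice (dT α γ) (dT γ β) with h | h <;> rw [h] at h1 <;> linarith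
  eq_of_dist_eq_zero := by
    intro α β h
    change twoPowNeg (dT α β) - (twoPowNeg (dT α α) + twoPowNeg (dT β β)) / 2 = 0 at h
    by_contra hne
    have h2 := twoPowNeg_strictAnti.antitone (dT_le_left α β)
    have h3 := twoPowNeg_strictAnti.antitone (dT_le_right α β)
    have e1 : dT α β = dT α α := twoPowNeg_strictAnti.injective (by linarith)
    have e2 : dT α β = dT β β := twoPowNeg_strictAnti.injective (by linarith)
    have hfin := dT_ne_top hne
    have s1 : commonPred α β = commonPred α α :=
      Set.Finite.eq_of_subset_of_encard_le' (Set.encard_ne_top_iff.mp (e1.symm.trans_ne hfin))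
        (fun _ hx => ⟨hx.1, hx.1⟩) e1.ge
    have s2 : commonPred α β = commonPred β β :=
      Set.Finite.eq_of_subset_of_encard_le' (Set.encard_ne_top_iff.mp (e2.symm.trans_ne hfin))
        (fun _ hx => ⟨hx.2, hx.2⟩) e2.ge
    have ha : α ∈ commonPred α β := s1 ▸ (⟨le_refl α, le_refl α⟩ : α ∈ commonPred α α)
    have hb : β ∈ commonPred α β := s2 ▸ (⟨le_refl β, le_refl β⟩ : β ∈ commonPred β β)
    exact hne (le_antisymm hb.1 ha.2)

end ClosedTree

/-- Vertices of the `d`-tree `T^d`. -/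
abbrev PolyTree (d : ℕ) : Type := Fin d → TreeVertex

/-- The closed `d`-tree, i.e. the `d`-fold product of `T ∪ ∂T`, with the coordinatewise order and
the product topology. -/
abbrev ClosedPolyTree (d : ℕ) : Type := Fin d → ClosedTree

/-- The sum `δ` of the coordinate metrics. -/
noncomputable def polyDelta {d : ℕ} (α β : ClosedPolyTree d) : ℝ := ∑ j, dist (α j) (β j)

/-- `δ` is equivalent to the distance that Lean uses on the product. -/
theorem dist_le_polyDelta {d : ℕ} (α β : ClosedPolyTree d) :
    dist α β ≤ polyDelta α β ∧ polyDelta α β ≤ d * dist α β := by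
  constructor
  · refine (dist_pi_le_iff (Finset.sum_nonneg fun _ _ => dist_nonneg)).mpr fun j => ?_
    exact Finset.single_le_sum (f := fun j => dist (α j) (β j)) (fun _ _ => dist_nonneg)
      (Finset.mem_univ j)
  · refine (Finset.sum_le_card_nsmul _ _ _ fun j _ => dist_le_pi_dist α β j).trans ?_
    simp

/-- The inclusion of `T^d` in the closed `d`-tree. -/
def PolyTree.toClosed {d : ℕ} (γ : PolyTree d) : ClosedPolyTree d := fun j => .vertex (γ j)

/-- The Hardy operator `(𝕀 f)(α) = ∑_{γ ≥ α} f(γ) π(γ)`, the sum being over the vertices `γ` of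
`T^d`. -/
noncomputable def hardy {d : ℕ} (π : PolyTree d → ℝ≥0) (f : PolyTree d → ℝ≥0)
    (α : ClosedPolyTree d) : ℝ≥0∞ :=
  ∑' γ : {γ : PolyTree d // α ≤ γ.toClosed}, (f γ : ℝ≥0∞) * (π γ : ℝ≥0∞)

/-- The `π`-capacity of a subset `E` of the closed `d`-tree: the infimum of `∫ f ^ 2 dπ` over all
`f ≥ 0` with `𝕀 f ≥ 1` on `E`. -/
noncomputable def treeCap {d : ℕ} (π : PolyTree d → ℝ≥0) (E : Set (ClosedPolyTree d)) : ℝ≥0∞ :=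
  ⨅ (f : PolyTree d → ℝ≥0) (_ : ∀ α ∈ E, 1 ≤ hardy π f α),
    ∑' γ : PolyTree d, (f γ : ℝ≥0∞) ^ 2 * (π γ : ℝ≥0∞)

/-- The standard polynomial product weight `π(β) = ∏_j 2 ^ (s_j d_T(β_j))`, where
`d_T(β_j)` is the distance of `β_j` to the root plus one. -/
noncomputable def stdWeight {d : ℕ} (s : Fin d → ℝ) (β : PolyTree d) : ℝ≥0 :=
  ∏ j, (2 : ℝ≥0) ^ (s j * (((β j).length + 1 : ℕ) : ℝ))

/-- The distinguished boundary `(∂T)^d`. -/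
def distinguishedBoundary (d : ℕ) : Set (ClosedPolyTree d) :=
  {ω | ∀ j, ∃ w : ℕ → Bool, ω j = .bdry w}

/-- The set `∂S(β)` of successors of `β` on the distinguished boundary. -/
def bdrySucc {d : ℕ} (β : ClosedPolyTree d) : Set (ClosedPolyTree d) :=
  {ω | ω ∈ distinguishedBoundary d ∧ ω ≤ β}

/-- The boundary projection `S_b(E)`, the union of `∂S(β)` over `β ∈ E`. -/
def bdryProj {d : ℕ} (E : Set (ClosedPolyTree d)) : Set (ClosedPolyTree d) :=
  ⋃ β ∈ E, bdrySucc β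

open MeasureTheory

/-! The lower bound is monotonicity: `𝕀 f` only grows when passing to successors, so any `f`
admissible for `E` is admissible for its projection.

For the converse, take `f` admissible for the projection. For `α ∈ E`, extend `α` by fair coin
tosses to a random point of `(∂T)^d` and average `𝕀 f ≥ 1`: the sum of `f π (γ)` times the
probability of landing below `γ` is at least 1. In each coordinate this probability is 0 or at most
`2⁻¹ ^ k`, with `k` the distance from some vertex above `α` down to `γ`. Moving the mass of `f π` up
to such vertices with factors `2⁻¹ ^ k` defines `pullBack`, which does not depend on `α` and is
admissible for `E` (`one_le_tsum_pullBack`). It is bounded on `ℓ²(π)` by a Schur test, as `2 ^ s j /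
2 < 1` (`exists_tsum_pullBack_sq_le`). Compactness plays no role. -/

/-- The sum over a finite product of a function with separated variables is the product of the
sums. -/
theorem ENNReal.tsum_pi_prod {ι : Type*} : ∀ {d : ℕ} (f : Fin d → ι → ℝ≥0∞),
    ∑' γ : Fin d → ι, ∏ j, f j (γ j) = ∏ j, ∑' a, f j a
  | 0, f => by simp [tsum_fintype]
  | d + 1, f => by
    rw [← (Fin.consEquiv fun _ : Fin (d + 1) => ι).tsum_eq, ENNReal.tsum_prod',
      Fin.prod_univ_succ, ← ENNReal.tsum_pi_prod fun j => f j.succ, ← ENNReal.tsum_mul_right]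
    refine tsum_congr fun a => ?_
    rw [← ENNReal.tsum_mul_left]
    refine tsum_congr fun γ => ?_
    simp [Fin.consEquiv, Fin.prod_univ_succ]

/-- Cauchy-Schwarz inequality for sums of extended nonnegative reals. -/
theorem ENNReal.tsum_sq_le_mul_of_sq_le {ι : Type*} {x y z : ι → ℝ≥0∞}
    (h : ∀ i, x i ^ 2 ≤ y i * z i) : (∑' i, x i) ^ 2 ≤ (∑' i, y i) * ∑' i, z i := by
  let _ : MeasurableSpace ι := ⊤
  have hx : ∀ i, x i ≤ y i ^ (1 / 2 : ℝ) * z i ^ (1 / 2 : ℝ) := fun i => by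
    rw [← ENNReal.mul_rpow_of_nonneg _ _ (by norm_num : (0 : ℝ) ≤ 1 / 2)]
    calc x i = (x i ^ 2) ^ (1 / 2 : ℝ) := by
          rw [← ENNReal.rpow_natCast, ← ENNReal.rpow_mul]; norm_num
      _ ≤ _ := ENNReal.rpow_le_rpow (h i) (by norm_num)
  have key := ENNReal.lintegral_mul_le_Lp_mul_Lq (Measure.count : Measure ι)
    (Real.HolderConjugate.two_two) (f := fun i => y i ^ (1 / 2 : ℝ))
    (g := fun i => z i ^ (1 / 2 : ℝ)) (measurable_from_top.aemeasurable)
    (measurable_from_top.aemeasurable)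
  simp only [lintegral_count, Pi.mul_apply, ← ENNReal.rpow_mul] at key
  norm_num at key
  calc (∑' i, x i) ^ 2 ≤ ((∑' i, y i) ^ (1 / 2 : ℝ) * (∑' i, z i) ^ (1 / 2 : ℝ)) ^ 2 := by
        gcongr
        exact (ENNReal.tsum_le_tsum hx).trans key
    _ = _ := by
        rw [mul_pow, ← ENNReal.rpow_natCast, ← ENNReal.rpow_natCast, ← ENNReal.rpow_mul,
          ← ENNReal.rpow_mul]
        norm_num

/-! ### Kernels on pairs of a vertex and a successor -/

/-- The number of words of length `n` is `2 ^ n`. -/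
theorem tsum_pow_length (r : ℝ≥0) :
    ∑' l : List Bool, ((r ^ l.length : ℝ≥0) : ℝ≥0∞) = ∑' n : ℕ, ((2 * r : ℝ≥0) : ℝ≥0∞) ^ n := by
  rw [← (Equiv.sigmaFiberEquiv (List.length : List Bool → ℕ)).tsum_eq, ENNReal.tsum_sigma']
  refine tsum_congr fun n => ?_
  have h : ∀ l : {l : List Bool // l.length = n},
      ((r ^ ((Equiv.sigmaFiberEquiv (List.length : List Bool → ℕ)) ⟨n, l⟩).length : ℝ≥0) : ℝ≥0∞)
        = (r : ℝ≥0∞) ^ n := by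
    rintro ⟨l, rfl⟩
    simp [Equiv.sigmaFiberEquiv]
  rw [tsum_congr h]
  have : Finite {l : List Bool // l.length = n} := inferInstanceAs (Finite (List.Vector Bool n))
  rw [ENNReal.tsum_const, ENat.card_eq_coe_natCard,
    show Nat.card {l : List Bool // l.length = n} = 2 ^ n from
      (Nat.card_eq_fintype_card (α := List.Vector Bool n)).trans (card_vector n),
    ENNReal.coe_mul, mul_pow]
  simp

/-- The kernel `r ^ (dist b c)` on the pairs with `c` a successor of `b`. -/
def prefixKernel (r : ℝ≥0) (b c : TreeVertex) : ℝ≥0 :=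
  if b <+: c then r ^ (c.length - b.length) else 0

/-- A vertex has `2 ^ n` successors at distance `n`, so the geometric ratio doubles. -/
theorem tsum_prefixKernel_right (r : ℝ≥0) (b : TreeVertex) :
    ∑' c, (prefixKernel r b c : ℝ≥0∞) = (1 - ((2 * r : ℝ≥0) : ℝ≥0∞))⁻¹ := by
  rw [← ENNReal.tsum_geometric, ← tsum_pow_length]
  have hinj : Function.Injective fun l : List Bool => b ++ l := fun _ _ h =>
    List.append_cancel_left h
  rw [← hinj.tsum_eq]
  · simp [prefixKernel]
  · intro c hc
    by_cases h : b <+: c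
    · obtain ⟨l, rfl⟩ := h
      exact ⟨l, rfl⟩
    · simp [prefixKernel, h] at hc

/-- There is at most one predecessor at each distance, so the ratio stays `r`; the sum stops at the
root, hence only an inequality. -/
theorem tsum_prefixKernel_left_le (r : ℝ≥0) (c : TreeVertex) :
    ∑' b, (prefixKernel r b c : ℝ≥0∞) ≤ (1 - (r : ℝ≥0∞))⁻¹ := by
  rw [← ENNReal.tsum_geometric]
  have hsub : Function.support (fun b => (prefixKernel r b c : ℝ≥0∞)) ⊆ {b | b <+: c} := by
    intro b hb
    by_contra h
    simp only [Set.mem_ofPred_eq] at h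
    simp [prefixKernel, h] at hb
  rw [← tsum_subtype_eq_of_support_subset hsub]
  have hinj : Function.Injective fun b : {b | b <+: c} => c.length - b.1.length := by
    rintro ⟨b, hb⟩ ⟨b', hb'⟩ h
    simp only [Set.mem_ofPred_eq] at hb hb'
    have h1 := hb.length_le
    have h2 := hb'.length_le
    have h3 : b.length = b'.length := by simp only at h; omega
    simp only [Subtype.mk.injEq]
    rw [List.prefix_iff_eq_take.mp hb, List.prefix_iff_eq_take.mp hb', h3]
  refine le_trans (le_of_eq (tsum_congr ?_))
    (ENNReal.tsum_comp_le_tsum_of_injective hinj fun n => (r : ℝ≥0∞) ^ n)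
  rintro ⟨b, hb⟩
  simp only [Set.mem_ofPred_eq] at hb
  simp [prefixKernel, hb]

/-- An exponential weight moves from the lower vertex to the upper one at the cost of rescaling the
ratio. -/
theorem prefixKernel_mul_pow_right (a r : ℝ≥0) (b c : TreeVertex) :
    prefixKernel r b c * a ^ (c.length + 1) = a ^ (b.length + 1) * prefixKernel (a * r) b c := by
  unfold prefixKernel
  split_ifs with h
  · obtain ⟨l, rfl⟩ := h
    simp only [List.length_append, Nat.add_sub_cancel_left]
    ring
  · simp

theorem prefixKernel_sq {a r t : ℝ≥0} (h : a ^ 2 = r * t) (b c : TreeVertex) :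
    prefixKernel a b c ^ 2 = prefixKernel r b c * prefixKernel t b c := by
  unfold prefixKernel
  split_ifs
  · rw [← mul_pow, ← h, ← pow_mul, ← pow_mul, mul_comm]
  · simp

/-- The tensor product of the kernels `prefixKernel (r j)`. -/
def polyKernel {d : ℕ} (r : Fin d → ℝ≥0) (β γ : PolyTree d) : ℝ≥0 :=
  ∏ j, prefixKernel (r j) (β j) (γ j)

theorem tsum_polyKernel_right {d : ℕ} (r : Fin d → ℝ≥0) (β : PolyTree d) :
    ∑' γ, (polyKernel r β γ : ℝ≥0∞) = ∏ j, (1 - ((2 * r j : ℝ≥0) : ℝ≥0∞))⁻¹ := by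
  simp only [polyKernel, ENNReal.ofNNReal_finsetProd]
  rw [ENNReal.tsum_pi_prod fun j c => (prefixKernel (r j) (β j) c : ℝ≥0∞)]
  exact Finset.prod_congr rfl fun j _ => tsum_prefixKernel_right _ _

theorem tsum_polyKernel_left_le {d : ℕ} (r : Fin d → ℝ≥0) (γ : PolyTree d) :
    ∑' β, (polyKernel r β γ : ℝ≥0∞) ≤ ∏ j, (1 - (r j : ℝ≥0∞))⁻¹ := by
  simp only [polyKernel, ENNReal.ofNNReal_finsetProd]
  rw [ENNReal.tsum_pi_prod fun j b => (prefixKernel (r j) b (γ j) : ℝ≥0∞)]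
  exact Finset.prod_le_prod' fun j _ => tsum_prefixKernel_left_le _ _

theorem polyKernel_sq {d : ℕ} {a r t : Fin d → ℝ≥0} (h : ∀ j, a j ^ 2 = r j * t j)
    (β γ : PolyTree d) : polyKernel a β γ ^ 2 = polyKernel r β γ * polyKernel t β γ := by
  simp only [polyKernel, ← Finset.prod_pow, ← Finset.prod_mul_distrib]
  exact Finset.prod_congr rfl fun j _ => prefixKernel_sq (h j) _ _

theorem stdWeight_eq_prod_pow {d : ℕ} (s : Fin d → ℝ) (β : PolyTree d) :
    stdWeight s β = ∏ j, ((2 : ℝ≥0) ^ s j) ^ ((β j).length + 1) := by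
  refine Finset.prod_congr rfl fun j _ => ?_
  rw [NNReal.rpow_mul, NNReal.rpow_natCast]

theorem stdWeight_ne_zero {d : ℕ} (s : Fin d → ℝ) (β : PolyTree d) : stdWeight s β ≠ 0 :=
  Finset.prod_ne_zero_iff.mpr fun _ _ => (NNReal.rpow_pos two_pos).ne'

theorem polyKernel_mul_stdWeight {d : ℕ} (s : Fin d → ℝ) (r : Fin d → ℝ≥0) (β γ : PolyTree d) :
    polyKernel r β γ * stdWeight s γ
      = stdWeight s β * polyKernel (fun j => 2 ^ s j * r j) β γ := by
  simp only [stdWeight_eq_prod_pow, polyKernel, ← Finset.prod_mul_distrib]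
  exact Finset.prod_congr rfl fun j _ => prefixKernel_mul_pow_right _ _ _ _

/-! ### The pull-back and its boundedness on `ℓ²(π)` -/

/-- The pull-back of `f` to the predecessors, with the kernel `∏ j, (2 ^ (s j) / 2) ^ k j`. -/
noncomputable def pullBack {d : ℕ} (s : Fin d → ℝ) (f : PolyTree d → ℝ≥0) (β : PolyTree d) :
    ℝ≥0∞ :=
  ∑' γ, (f γ : ℝ≥0∞) * (polyKernel (fun j => 2 ^ s j * 2⁻¹) β γ : ℝ≥0∞)

theorem pullBack_mul_stdWeight {d : ℕ} (s : Fin d → ℝ) (f : PolyTree d → ℝ≥0) (β : PolyTree d) :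
    pullBack s f β * (stdWeight s β : ℝ≥0∞)
      = ∑' γ, (f γ : ℝ≥0∞) * (stdWeight s γ : ℝ≥0∞) * (polyKernel (fun _ => 2⁻¹) β γ : ℝ≥0∞) := by
  rw [pullBack, ← ENNReal.tsum_mul_right]
  refine tsum_congr fun γ => ?_
  norm_cast
  rw [mul_assoc, mul_assoc, mul_comm (polyKernel _ _ _), ← polyKernel_mul_stdWeight,
    mul_comm (polyKernel _ _ _)]

/-- The pull-back is bounded on `ℓ²(π)`, by the Schur test. -/
theorem exists_tsum_pullBack_sq_le {d : ℕ} (s : Fin d → ℝ) (hs : ∀ j, s j < 1) :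
    ∃ C : ℝ≥0∞, C ≠ ⊤ ∧ ∀ f : PolyTree d → ℝ≥0,
      ∑' β, pullBack s f β ^ 2 * (stdWeight s β : ℝ≥0∞)
        ≤ C * ∑' γ, (f γ : ℝ≥0∞) ^ 2 * (stdWeight s γ : ℝ≥0∞) := by
  -- The square root splits the decay `2 ^ s j / 2 = θ j ^ 2` evenly between the two Schur sums,
  -- each then geometric of ratio `θ j < 1`.
  set θ : Fin d → ℝ≥0 := fun j => NNReal.sqrt (2 ^ s j * 2⁻¹) with hθ
  have hθ1 : ∀ j, θ j < 1 := fun j => by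
    rw [hθ, ← NNReal.sqrt_one, NNReal.sqrt_lt_sqrt]
    rw [← div_eq_mul_inv, div_lt_one two_pos]
    calc (2 : ℝ≥0) ^ s j < 2 ^ (1 : ℝ) := NNReal.rpow_lt_rpow_of_exponent_lt one_lt_two (hs j)
      _ = 2 := NNReal.rpow_one _
  -- The factor `θ / 2` is summed over successors, where doubling gives `θ`; the factor `2 ^ s * θ`
  -- becomes `θ` once the weight is moved from `β` to `γ`.
  have hsq : ∀ j, ((2 : ℝ≥0) ^ s j * 2⁻¹) ^ 2 = (θ j * 2⁻¹) * (2 ^ s j * θ j) := fun j => by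
    have h : θ j * θ j = 2 ^ s j * 2⁻¹ := NNReal.mul_self_sqrt _
    calc ((2 : ℝ≥0) ^ s j * 2⁻¹) ^ 2 = (2 ^ s j * 2⁻¹) * (2 ^ s j * 2⁻¹) := sq _
      _ = (2 ^ s j * 2⁻¹) * (θ j * θ j) := by rw [h]
      _ = _ := by ring
  set A : ℝ≥0∞ := ∏ j, (1 - (θ j : ℝ≥0∞))⁻¹ with hA
  have hAtop : A ≠ ⊤ := ENNReal.prod_ne_top fun j _ => by
    rw [ENNReal.inv_ne_top]
    exact (tsub_pos_of_lt (by exact_mod_cast hθ1 j)).ne'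
  have hright : ∀ β : PolyTree d, ∑' γ, (polyKernel (fun j => θ j * 2⁻¹) β γ : ℝ≥0∞) = A := by
    intro β
    rw [tsum_polyKernel_right]
    refine Finset.prod_congr rfl fun j _ => ?_
    rw [mul_comm (θ j), mul_inv_cancel_left₀ two_ne_zero]
  refine ⟨A * A, ENNReal.mul_ne_top hAtop hAtop, fun f => ?_⟩
  have hg : ∀ β, pullBack s f β ^ 2
      ≤ A * ∑' γ, (f γ : ℝ≥0∞) ^ 2 * (polyKernel (fun j => 2 ^ s j * θ j) β γ : ℝ≥0∞) := by
    intro β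
    rw [← hright β]
    refine ENNReal.tsum_sq_le_mul_of_sq_le fun γ => le_of_eq ?_
    rw [mul_pow, ← ENNReal.coe_pow (polyKernel _ _ _), polyKernel_sq hsq, ENNReal.coe_mul]
    ring
  calc ∑' β, pullBack s f β ^ 2 * (stdWeight s β : ℝ≥0∞)
      ≤ ∑' β, A * ∑' γ, (f γ : ℝ≥0∞) ^ 2 * (stdWeight s γ : ℝ≥0∞) * (polyKernel θ β γ : ℝ≥0∞) := by
        refine ENNReal.tsum_le_tsum fun β => ?_
        refine (mul_le_mul_left (hg β) _).trans (le_of_eq ?_)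
        rw [mul_assoc, ← ENNReal.tsum_mul_right]
        congr 1
        refine tsum_congr fun γ => ?_
        rw [mul_assoc, mul_assoc, ← ENNReal.coe_mul, ← ENNReal.coe_mul,
          mul_comm (polyKernel _ _ _), ← polyKernel_mul_stdWeight, mul_comm (polyKernel _ _ _)]
    _ = A * ∑' γ, (f γ : ℝ≥0∞) ^ 2 * (stdWeight s γ : ℝ≥0∞)
          * ∑' β, (polyKernel θ β γ : ℝ≥0∞) := by
        rw [ENNReal.tsum_mul_left, ENNReal.tsum_comm]
        simp only [ENNReal.tsum_mul_left]
    _ ≤ A * ∑' γ, (f γ : ℝ≥0∞) ^ 2 * (stdWeight s γ : ℝ≥0∞) * A := by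
        gcongr with γ
        exact tsum_polyKernel_left_le θ γ
    _ = _ := by rw [ENNReal.tsum_mul_right]; ring

/-! ### Averaging over random boundary points -/

/-- The law of a sequence of independent fair coin tosses. -/
noncomputable def coinMeasure : Measure (ℕ → Bool) :=
  Measure.infinitePi fun _ => (PMF.uniformOfFintype Bool).toMeasure

instance : IsProbabilityMeasure coinMeasure := by unfold coinMeasure; infer_instance

/-- The boundary point below `a` whose choices after the end of `a` are those of `x`. -/
def ClosedTree.extend : ClosedTree → (ℕ → Bool) → ℕ → Bool
  | .vertex v, x => fun i => v.getD i (x i)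
  | .bdry ω, _ => ω

theorem ClosedTree.extend_le (a : ClosedTree) (x : ℕ → Bool) : bdry (a.extend x) ≤ a := by
  rcases a with v | ω
  · intro i hi
    simp [extend, hi]
  · rfl

theorem ClosedTree.measurable_extend (a : ClosedTree) : Measurable a.extend := by
  rcases a with v | ω
  · refine measurable_pi_iff.mpr fun i => ?_
    by_cases hi : i < v.length
    · simp [extend, hi]
    · simpa [extend, hi] using measurable_pi_apply i
  · exact measurable_const

theorem ClosedTree.measurableSet_bdry_le (a : ClosedTree) (c : TreeVertex) :
    MeasurableSet {x | bdry (a.extend x) ≤ vertex c} := by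
  have h : MeasurableSet {y : ℕ → Bool | ∀ (i : ℕ) (h : i < c.length), c.get ⟨i, h⟩ = y i} := by
    simp only [Set.ofPred_forall]
    exact MeasurableSet.iInter fun i => MeasurableSet.iInter fun h =>
      measurableSet_eq_fun measurable_const (measurable_pi_apply i)
  exact a.measurable_extend h

theorem coinMeasure_extend_vertex_le {b c : TreeVertex} (h : b <+: c) :
    coinMeasure {x | ClosedTree.bdry ((ClosedTree.vertex b).extend x) ≤ .vertex c}
      ≤ (prefixKernel 2⁻¹ b c : ℝ≥0∞) := by
  -- Only the tosses between the two lengths are constrained; the default `false` is never read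
  -- there.
  have hsub : {x | ClosedTree.bdry ((ClosedTree.vertex b).extend x) ≤ .vertex c}
      ⊆ Set.pi (Finset.Ico b.length c.length : Finset ℕ) fun i => {c.getD i false} := by
    intro x hx i hi
    rw [Finset.coe_Ico, Set.mem_Ico] at hi
    have := hx i hi.2
    simp [ClosedTree.extend, hi.1] at this
    simp [hi.2, this]
  refine (measure_mono hsub).trans (le_of_eq ?_)
  rw [coinMeasure, Measure.infinitePi_pi _ fun _ _ => measurableSet_singleton _]
  simp only [PMF.toMeasure_apply_singleton _ _ (measurableSet_singleton _)]
  simp [prefixKernel, h, ENNReal.inv_pow]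

/-- For a random boundary point below `a`, the probability of lying below the vertex `c` is
controlled by the kernel at a vertex above `a`. -/
theorem coinMeasure_bdry_le_eq_zero_or (a : ClosedTree) (c : TreeVertex) :
    coinMeasure {x | ClosedTree.bdry (a.extend x) ≤ .vertex c} = 0 ∨
      ∃ b : TreeVertex, a ≤ .vertex b ∧
        coinMeasure {x | ClosedTree.bdry (a.extend x) ≤ .vertex c}
          ≤ (prefixKernel 2⁻¹ b c : ℝ≥0∞) := by
  by_cases hac : a ≤ .vertex c
  · exact Or.inr ⟨c, hac, by simpa [prefixKernel] using prob_le_one⟩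
  by_cases hca : ClosedTree.vertex c ≤ a
  · rcases a with b | ω
    · exact Or.inr ⟨b, le_rfl, coinMeasure_extend_vertex_le hca⟩
    · exact hca.elim
  · left
    convert measure_empty (μ := coinMeasure)
    refine Set.eq_empty_of_forall_notMem fun x hx => ?_
    exact (ClosedTree.chain (a.extend_le x) hx).elim hac hca

theorem hardy_eq_tsum_indicator {d : ℕ} (π f : PolyTree d → ℝ≥0) (α : ClosedPolyTree d) :
    hardy π f α
      = ∑' γ, {γ : PolyTree d | α ≤ γ.toClosed}.indicator
          (fun γ => (f γ : ℝ≥0∞) * (π γ : ℝ≥0∞)) γ :=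
  tsum_subtype {γ : PolyTree d | α ≤ γ.toClosed} fun γ => (f γ : ℝ≥0∞) * (π γ : ℝ≥0∞)

theorem hardy_anti {d : ℕ} (π f : PolyTree d → ℝ≥0) {α β : ClosedPolyTree d} (h : α ≤ β) :
    hardy π f β ≤ hardy π f α :=
  ENNReal.tsum_mono_subtype (fun γ => (f γ : ℝ≥0∞) * (π γ : ℝ≥0∞))
    fun γ (hγ : β ≤ γ.toClosed) => h.trans hγ

/-- If `𝕀 f ≥ 1` on the distinguished boundary below `α`, then the same holds at `α` for the
pull-back of `f`: average over that boundary set. -/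
theorem one_le_tsum_pullBack {d : ℕ} (s : Fin d → ℝ) (f : PolyTree d → ℝ≥0)
    (α : ClosedPolyTree d) (h : ∀ ω ∈ bdrySucc α, 1 ≤ hardy (stdWeight s) f ω) :
    1 ≤ ∑' η : {η : PolyTree d // α ≤ η.toClosed},
      pullBack s f η * (stdWeight s η : ℝ≥0∞) := by
  set μ : Measure (Fin d → ℕ → Bool) := Measure.pi fun _ => coinMeasure with hμ
  set ρ : (Fin d → ℕ → Bool) → ClosedPolyTree d := fun x j => .bdry ((α j).extend (x j)) with hρ
  set S : PolyTree d → Set (Fin d → ℕ → Bool) := fun γ => {x | ρ x ≤ γ.toClosed} with hSdef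
  have hS : ∀ γ, S γ = Set.univ.pi fun j =>
      {x | ClosedTree.bdry ((α j).extend x) ≤ .vertex (γ j)} := fun γ => by
    ext x
    simp [hSdef, hρ, Pi.le_def, PolyTree.toClosed]
  have hSm : ∀ γ, MeasurableSet (S γ) := fun γ => by
    rw [hS]
    exact MeasurableSet.univ_pi fun j => ClosedTree.measurableSet_bdry_le _ _
  -- By independence the probability is a product over coordinates. If no factor vanishes, it is at
  -- most the kernel at one vertex `η` above `α`, hence at most the sum over all of them.
  have hSle : ∀ γ, μ (S γ)
      ≤ ∑' η : {η : PolyTree d // α ≤ η.toClosed},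
        (polyKernel (fun _ => 2⁻¹) (η : PolyTree d) γ : ℝ≥0∞) := fun γ => by
    rw [hS, hμ, Measure.pi_pi]
    by_cases h0 : ∃ j, coinMeasure
        {x | ClosedTree.bdry ((α j).extend x) ≤ .vertex (γ j)} = 0
    · obtain ⟨j, hj⟩ := h0
      rw [Finset.prod_eq_zero (Finset.mem_univ j) hj]
      exact zero_le
    · push Not at h0
      choose η hη hle using fun j =>
        (coinMeasure_bdry_le_eq_zero_or (α j) (γ j)).resolve_left (h0 j)
      refine (Finset.prod_le_prod' fun j _ => hle j).trans ?_
      rw [← ENNReal.ofNNReal_finsetProd]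
      exact ENNReal.le_tsum
        (f := fun η : {η : PolyTree d // α ≤ η.toClosed} =>
          (polyKernel (fun _ => 2⁻¹) (η : PolyTree d) γ : ℝ≥0∞)) ⟨η, hη⟩
  have hind : ∀ γ x, {γ : PolyTree d | ρ x ≤ γ.toClosed}.indicator
      (fun γ => (f γ : ℝ≥0∞) * (stdWeight s γ : ℝ≥0∞)) γ
        = (S γ).indicator (fun _ => (f γ : ℝ≥0∞) * (stdWeight s γ : ℝ≥0∞)) x := fun _ _ => rfl
  calc (1 : ℝ≥0∞) = ∫⁻ _, 1 ∂μ := by simp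
    _ ≤ ∫⁻ x, hardy (stdWeight s) f (ρ x) ∂μ :=
        lintegral_mono fun x => h _ ⟨fun j => ⟨_, rfl⟩, fun j => ClosedTree.extend_le _ _⟩
    _ = ∑' γ, (f γ : ℝ≥0∞) * (stdWeight s γ : ℝ≥0∞) * μ (S γ) := by
        simp only [hardy_eq_tsum_indicator, hind]
        rw [lintegral_tsum fun γ => (measurable_const.indicator (hSm γ)).aemeasurable]
        exact tsum_congr fun γ => lintegral_indicator_const (hSm γ) _
    _ ≤ ∑' γ, (f γ : ℝ≥0∞) * (stdWeight s γ : ℝ≥0∞)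
          * ∑' η : {η : PolyTree d // α ≤ η.toClosed},
            (polyKernel (fun _ => 2⁻¹) (η : PolyTree d) γ : ℝ≥0∞) := by
        gcongr with γ
        exact hSle γ
    _ = _ := by
        simp only [pullBack_mul_stdWeight, ← ENNReal.tsum_mul_left]
        exact ENNReal.tsum_comm

/-! ### Comparison of the capacities -/

theorem treeCap_bdryProj_le {d : ℕ} (π : PolyTree d → ℝ≥0) (E : Set (ClosedPolyTree d)) :
    treeCap π (bdryProj E) ≤ treeCap π E := by
  refine le_iInf₂ fun f hf => iInf₂_le f fun ω hω => ?_
  simp only [bdryProj, Set.mem_iUnion] at hω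
  obtain ⟨β, hβ, hω⟩ := hω
  exact (hf β hβ).trans (hardy_anti π f hω.2)

theorem exists_treeCap_le_mul_treeCap_bdryProj {d : ℕ} (s : Fin d → ℝ) (hs : ∀ j, s j < 1) :
    ∃ C : ℝ, 1 < C ∧ ∀ E : Set (ClosedPolyTree d),
      treeCap (stdWeight s) E ≤ ENNReal.ofReal C * treeCap (stdWeight s) (bdryProj E) := by
  obtain ⟨A, hA, hbound⟩ := exists_tsum_pullBack_sq_le s hs
  -- Adding 2 forces a constant above 1 without a lower bound on `A`.
  have hC : 1 < A.toReal + 2 := by linarith [A.toReal_nonneg]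
  have hAC : A ≤ ENNReal.ofReal (A.toReal + 2) := by
    rw [← ENNReal.ofReal_toReal hA]
    exact ENNReal.ofReal_le_ofReal (by simp)
  have hC0 : ENNReal.ofReal (A.toReal + 2) ≠ 0 := by
    rw [Ne, ENNReal.ofReal_eq_zero]; linarith
  refine ⟨A.toReal + 2, hC, fun E => ?_⟩
  rw [treeCap, treeCap, ENNReal.mul_iInf_of_ne hC0 ENNReal.ofReal_ne_top]
  refine le_iInf fun f => ?_
  rw [ENNReal.mul_iInf_of_ne hC0 ENNReal.ofReal_ne_top]
  refine le_iInf fun hf => ?_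
  set N : ℝ≥0∞ := ∑' γ, (f γ : ℝ≥0∞) ^ 2 * (stdWeight s γ : ℝ≥0∞) with hN
  by_cases hNtop : N = ⊤
  · rw [hNtop, ENNReal.mul_top hC0]
    exact le_top
  -- Finite energy and a nonvanishing weight make the pull-back finite everywhere, so `toNNReal`
  -- below loses nothing.
  have hfin : ∀ β, pullBack s f β ≠ ⊤ := fun β hβ => by
    have h := (ENNReal.le_tsum β).trans (hbound f)
    rw [hβ, ENNReal.top_pow two_ne_zero,
      ENNReal.top_mul (ENNReal.coe_ne_zero.mpr (stdWeight_ne_zero s β)), top_le_iff] at h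
    exact ENNReal.mul_ne_top hA hNtop h
  refine (iInf₂_le (fun β => (pullBack s f β).toNNReal) fun α hα => ?_).trans ?_
  · simp only [hardy, ENNReal.coe_toNNReal (hfin _)]
    refine one_le_tsum_pullBack s f α fun ω hω => hf ω ?_
    exact Set.mem_biUnion hα hω
  · simp only [ENNReal.coe_toNNReal (hfin _)]
    exact (hbound f).trans (mul_le_mul_left hAC _)

theorem corollary1 (d : ℕ) (s : Fin d → ℝ) (hs : ∀ j, 0 ≤ s j ∧ s j < 1) :
    ∃ C : ℝ, 1 < C ∧ ∀ E : Set (ClosedPolyTree d), IsCompact E →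
      treeCap (stdWeight s) (bdryProj E) ≤ treeCap (stdWeight s) E ∧
      treeCap (stdWeight s) E ≤ ENNReal.ofReal C * treeCap (stdWeight s) (bdryProj E) := by
  obtain ⟨C, hC, h⟩ := exists_treeCap_le_mul_treeCap_bdryProj s fun j => (hs j).2
  exact ⟨C, hC, fun E _ => ⟨treeCap_bdryProj_le _ E, h E⟩⟩
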